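/- Let $\mathcal H$ be a separable complex Hilbert space, with inner product linear in the first argument. Let $(s_k)_{k\ge1}$ be a frame for its closed linear span $\mathcal S$, and let $(w_k)_{k\ge1}$ be a Riesz basis for its closed linear span $\mathcal W$, with synthesis operators $S,W:\ell^2\to\mathcal H$, $Sx=\sum_k x_ks_k$, $Wx=\sum_k x_kw_k$, so that $S^*h=(\langle h,s_k\rangle)_k$. Assume $\mathcal W\cap\mathcal S^\perp=\{0\}$. Fix an integer $n\ge1$, let $\iota_n:\mathbb C^n\to\ell^2$ be the inclusion $(x_1,\dots,x_n)\mapsto(x_1,\dots,x_n,0,0,\dots)$, let $(e_j)_{j\ge1}$ be the canonical basis of $\ell^2$, and put $\mathcal W_n=\operatorname{span}\{w_1,\dots,w_n\}$, $U=S^*W$, $\Sigma=\iota_n^*U^*U\iota_n$ and $v_j=\iota_n^*U^*e_j\in\mathbb C^n$. (Under these assumptions $\Sigma$ is invertible.) Let $p=(p_j)_{j\ge1}$ be a probability distribution on the positive integers such that $p_j>0$ whenever $v_j\ne0$, and such that $$R:=\sup_{j:\,p_j>0}\frac{\|v_j\|^2}{p_j}<\infty .$$ Let $f\in\mathcal H$,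 let $i_1,\dots,i_m$ be independent random indices with law $p$, and set $$Q_\Omega=\frac1m\sum_{t=1}^m\frac{e_{i_t}\otimes e_{i_t}}{p_{i_t}},\qquad \widehat\Sigma_\Omega=\iota_n^*U^*Q_\Omega U\iota_n,\qquad \widehat C_\Omega=\iota_n^*U^*Q_\Omega S^*P_{\mathcal W_n^\perp},$$ where $(e\otimes e)x=\langle x,e\rangle e$ and $P_{\mathcal W_n^\perp}$ is the orthogonal projection of $\mathcal H$ onto $\mathcal W_n^\perp$. Let $\delta\in(0,1)$. If $$m\ \ge\ \frac83\,R\,\|\Sigma\|\,\|\Sigma^{-1}\|^2\,\log(2n/\delta),$$ where $\|\cdot\|$ is the operator norm, then with probability at least $1-\delta$ the weighted least-squares problem $$\min_{x\in\mathbb C^n}\ \sum_{t=1}^m\frac1{p_{i_t}}\bigl|\langle W\iota_nx,s_{i_t}\rangle-\langle f,s_{i_t}\rangle\bigr|^2$$ has a unique solution $\tilde x$. Moreover, almost surely on the event that the solution is unique, $\widehat\Sigma_\Omega$ is invertible and $\tilde f:=W\iota_n\tilde x$ satisfies $$\|f-\tilde f\|\le\|P_{\mathcal W_n^\perp}f\|\,\bigl(1+K_{n,\Omega}^2\bigr)^{1/2},\qquad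 K_{n,\Omega}:=\bigl\|W\iota_n\widehat\Sigma_\Omega^{-1}\widehat C_\Omega\bigr\| .$$ -/

import Mathlib

namespace StochasticGS

noncomputable section

open scoped InnerProductSpace

/-- The Hilbert space of square summable complex sequences. Indices run over `0, 1, 2, ...`. -/
abbrev SeqSpace : Type := lp (fun _ : ℕ => ℂ) 2

variable {H : Type*} [NormedAddCommGroup H] [InnerProductSpace ℂ H]

/-- The closed linear span of a sequence. -/
def closedSpan (v : ℕ → H) : Submodule ℂ H :=
  (Submodule.span ℂ (Set.range v)).topologicalClosure

/-- `v` is a frame for its closed linear span. Mathlib's inner product is linear in the second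
argument, so `⟪v k, h⟫_ℂ` is the coefficient of `h` against `v k`. -/
def IsFrameSeq (v : ℕ → H) : Prop :=
  ∃ A B : ℝ, 0 < A ∧ 0 < B ∧ ∀ h ∈ closedSpan v,
    Summable (fun k => ‖⟪v k, h⟫_ℂ‖ ^ 2) ∧
    A * ‖h‖ ^ 2 ≤ ∑' k, ‖⟪v k, h⟫_ℂ‖ ^ 2 ∧
    ∑' k, ‖⟪v k, h⟫_ℂ‖ ^ 2 ≤ B * ‖h‖ ^ 2

/-- `v` is a Riesz sequence, that is, a Riesz basis for its closed linear span. -/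
def IsRieszSeq (v : ℕ → H) : Prop :=
  ∃ C D : ℝ, 0 < C ∧ 0 < D ∧ ∀ x : SeqSpace,
    Summable (fun k => x k • v k) ∧
    C * ‖x‖ ^ 2 ≤ ‖∑' k, x k • v k‖ ^ 2 ∧
    ‖∑' k, x k • v k‖ ^ 2 ≤ D * ‖x‖ ^ 2

/-- The upper frame inequality on the whole space; it is what makes the analysis and synthesis
operators of a sequence bounded. -/
def IsBesselSeq (v : ℕ → H) : Prop :=
  ∃ B : ℝ, ∀ h : H,
    Summable (fun k => ‖⟪v k, h⟫_ℂ‖ ^ 2) ∧ ∑' k, ‖⟪v k, h⟫_ℂ‖ ^ 2 ≤ B * ‖h‖ ^ 2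

theorem IsFrameSeq.isBesselSeq [CompleteSpace H] {v : ℕ → H} (hv : IsFrameSeq v) :
    IsBesselSeq v := by
  obtain ⟨A, B, -, hB, h⟩ := hv
  have : CompleteSpace (closedSpan v) :=
    (Submodule.isClosed_topologicalClosure _).completeSpace_coe
  refine ⟨B, fun g => ?_⟩
  have hmem : ∀ k, v k ∈ closedSpan v := fun k =>
    Submodule.le_topologicalClosure _ (Submodule.subset_span ⟨k, rfl⟩)
  have key : ∀ k, ⟪v k, g⟫_ℂ = ⟪v k, (closedSpan v).starProjection g⟫_ℂ := by
    intro k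
    have := (Submodule.mem_orthogonal _ _).1
      (Submodule.sub_starProjection_mem_orthogonal (K := closedSpan v) g) (v k) (hmem k)
    rw [inner_sub_right, sub_eq_zero] at this
    exact this
  obtain ⟨h1, -, h3⟩ := h _ (Submodule.starProjection_apply_mem (closedSpan v) g)
  simp only [key]
  refine ⟨h1, h3.trans ?_⟩
  gcongr
  exact Submodule.norm_starProjection_apply_le _ _

theorem IsRieszSeq.isBesselSeq {v : ℕ → H} (hv : IsRieszSeq v) : IsBesselSeq v := by
  obtain ⟨C, D, -, hD, h⟩ := hv
  refine ⟨D, fun g => ?_⟩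
  have key : ∀ F : Finset ℕ, ∑ k ∈ F, ‖⟪v k, g⟫_ℂ‖ ^ 2 ≤ D * ‖g‖ ^ 2 := by
    intro F
    set N := ∑ k ∈ F, ‖⟪v k, g⟫_ℂ‖ ^ 2 with hN
    have hN0 : 0 ≤ N := Finset.sum_nonneg fun k _ => by positivity
    set x : SeqSpace := ∑ k ∈ F, lp.single 2 k ⟪v k, g⟫_ℂ with hx
    have hxk : ∀ k, x k = if k ∈ F then ⟪v k, g⟫_ℂ else 0 := by
      intro k
      rw [hx, lp.coeFn_sum, Finset.sum_apply]
      simp [Pi.single_apply]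
    have hxn : ‖x‖ ^ 2 = N := by
      have := lp.norm_sum_single (E := fun _ : ℕ => ℂ) (p := 2) (by norm_num)
        (fun k => ⟪v k, g⟫_ℂ) F
      simpa [hN] using this
    have ht : ∑' k, x k • v k = ∑ k ∈ F, ⟪v k, g⟫_ℂ • v k := by
      rw [tsum_eq_sum (s := F) (fun k hk => by simp [hxk, hk])]
      exact Finset.sum_congr rfl fun k hk => by simp [hxk, hk]
    have h2 := (h x).2.2
    rw [ht, hxn] at h2
    have hin : ⟪g, ∑ k ∈ F, ⟪v k, g⟫_ℂ • v k⟫_ℂ = (N : ℂ) := by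
      rw [inner_sum, hN]
      push_cast
      refine Finset.sum_congr rfl fun k _ => ?_
      rw [inner_smul_right, ← inner_conj_symm g (v k), Complex.mul_conj, Complex.normSq_eq_norm_sq]
      push_cast
      rfl
    have hcs := norm_inner_le_norm (𝕜 := ℂ) g (∑ k ∈ F, ⟪v k, g⟫_ℂ • v k)
    rw [hin, Complex.norm_real, Real.norm_of_nonneg hN0] at hcs
    have h3 : N ^ 2 ≤ ‖g‖ ^ 2 * (D * N) := by
      calc N ^ 2 ≤ (‖g‖ * ‖∑ k ∈ F, ⟪v k, g⟫_ℂ • v k‖) ^ 2 := by gcongr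
        _ = ‖g‖ ^ 2 * ‖∑ k ∈ F, ⟪v k, g⟫_ℂ • v k‖ ^ 2 := by ring
        _ ≤ _ := by gcongr
    rcases hN0.eq_or_lt with h0 | h0
    · rw [← h0]; positivity
    · nlinarith
  have hs : Summable (fun k => ‖⟪v k, g⟫_ℂ‖ ^ 2) :=
    summable_of_sum_le (fun k => by positivity) key
  exact ⟨hs, hs.tsum_le_of_sum_le key⟩

/-- The analysis operator `h ↦ (⟨h, v k⟩)ₖ`. -/
def analysis (v : ℕ → H) (hv : IsBesselSeq v) : H →L[ℂ] SeqSpace :=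
  LinearMap.mkContinuousOfExistsBound
    { toFun := fun h => (⟨fun k => ⟪v k, h⟫_ℂ, by
        obtain ⟨B, hB⟩ := hv
        exact memℓp_gen (by simpa using (hB h).1)⟩ : SeqSpace)
      map_add' := fun x y => by ext k; exact inner_add_right _ _ _
      map_smul' := fun c x => by ext k; exact inner_smul_right _ _ _ }
    (by
      obtain ⟨B, hB⟩ := hv
      refine ⟨Real.sqrt (max B 0), fun h => ?_⟩
      refine lp.norm_le_of_tsum_le (by norm_num) (by positivity) ?_
      have h1 := (hB h).2
      simp only [ENNReal.toReal_ofNat, Real.rpow_ofNat, mul_pow]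
      rw [Real.sq_sqrt (le_max_right _ _)]
      refine h1.trans ?_
      gcongr
      exact le_max_left _ _)

@[simp]
theorem analysis_apply (v : ℕ → H) (hv : IsBesselSeq v) (h : H) (k : ℕ) :
    analysis v hv h k = ⟪v k, h⟫_ℂ := rfl

variable [CompleteSpace H]

/-- The synthesis operator `x ↦ ∑ₖ xₖ vₖ` (see `hasSum_synthesis`), the adjoint of the analysis
operator. -/
def synthesis (v : ℕ → H) (hv : IsBesselSeq v) : SeqSpace →L[ℂ] H :=
  (analysis v hv).adjoint

theorem hasSum_synthesis (v : ℕ → H) (hv : IsBesselSeq v) (x : SeqSpace) :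
    HasSum (fun k => x k • v k) (synthesis v hv x) := by
  have h1 := (lp.hasSum_single (E := fun _ : ℕ => ℂ) (p := 2) (by norm_num) x).mapL
    (synthesis v hv)
  convert h1 using 2 with k
  refine ext_inner_right ℂ fun h => ?_
  rw [synthesis, ContinuousLinearMap.adjoint_inner_left, lp.inner_single_left, analysis_apply,
    inner_smul_left]
  simp [mul_comm]

/-- The inclusion `ℂⁿ → ℓ²`, `(x₁, ..., xₙ) ↦ (x₁, ..., xₙ, 0, 0, ...)`. -/
def incl (n : ℕ) : EuclideanSpace ℂ (Fin n) →L[ℂ] SeqSpace :=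
  ∑ k : Fin n, (EuclideanSpace.proj k : EuclideanSpace ℂ (Fin n) →L[ℂ] ℂ).smulRight
    (lp.single 2 (k : ℕ) (1 : ℂ) : SeqSpace)

theorem incl_apply (n : ℕ) (x : EuclideanSpace ℂ (Fin n)) (j : ℕ) :
    incl n x j = if h : j < n then x ⟨j, h⟩ else 0 := by
  have : incl n x j = ∑ k : Fin n, if j = (k : ℕ) then x k else 0 := by
    simp only [incl, _root_.sum_apply, lp.coeFn_sum, Finset.sum_apply]
    simp [Pi.single_apply]
  rw [this]
  split_ifs with h
  · rw [Finset.sum_eq_single (⟨j, h⟩ : Fin n)]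
    · simp
    · intro b _ hb
      exact if_neg fun h' => hb (Fin.ext h'.symm)
    · simp
  · refine Finset.sum_eq_zero fun k _ => if_neg ?_
    have := k.2
    omega

/-- The reconstruction space: the span of the first `n` vectors. -/
def reconSpace (w : ℕ → H) (n : ℕ) : Submodule ℂ H :=
  Submodule.span ℂ (Set.range fun k : Fin n => w k)

/-- The orthogonal projection onto the orthogonal complement of the reconstruction space, as an
operator on `H`. -/
def tailProj (w : ℕ → H) (n : ℕ) : H →L[ℂ] H := (reconSpace w n)ᗮ.starProjection

section Operators

variable (s w : ℕ → H) (hs : IsBesselSeq s) (hw : IsBesselSeq w) (n : ℕ)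

/-- `U = S* W`. -/
def crossOp : SeqSpace →L[ℂ] SeqSpace := analysis s hs ∘L synthesis w hw

/-- `U ιₙ : ℂⁿ → ℓ²`. -/
def crossOpFin : EuclideanSpace ℂ (Fin n) →L[ℂ] SeqSpace := crossOp s w hs hw ∘L incl n

/-- The finite section `Σ = ιₙ* U* U ιₙ`. -/
def gram : EuclideanSpace ℂ (Fin n) →L[ℂ] EuclideanSpace ℂ (Fin n) :=
  (crossOpFin s w hs hw n).adjoint ∘L crossOpFin s w hs hw n

/-- The interaction vector `vⱼ = ιₙ* U* eⱼ`. -/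
def interaction (j : ℕ) : EuclideanSpace ℂ (Fin n) :=
  (crossOpFin s w hs hw n).adjoint (lp.single 2 j (1 : ℂ) : SeqSpace)

/-- The coherence ratios `‖vⱼ‖² / pⱼ`, for `j` in the support of `p`. -/
def coherenceRatio (p : PMF ℕ) (j : p.support) : ℝ :=
  ‖interaction s w hs hw n j‖ ^ 2 / (p j).toReal

/-- The coherence `R`, the supremum over the support of `p` of `‖vⱼ‖² / pⱼ`. -/
def coherence (p : PMF ℕ) : ℝ := ⨆ j : p.support, coherenceRatio s w hs hw n p j

/-- The weighted sampling operator `Q = (1/m) ∑ₜ (e_{iₜ} ⊗ e_{iₜ}) / p_{iₜ}` on `ℓ²`. -/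
def sampleOp (p : PMF ℕ) {m : ℕ} (i : Fin m → ℕ) : SeqSpace →L[ℂ] SeqSpace :=
  ((m : ℂ)⁻¹) • ∑ t, (((p (i t)).toReal : ℂ)⁻¹) •
    InnerProductSpace.rankOne ℂ (lp.single 2 (i t) (1 : ℂ) : SeqSpace)
      (lp.single 2 (i t) (1 : ℂ) : SeqSpace)

/-- The empirical Gram matrix `ιₙ* U* Q U ιₙ`. -/
def empGram (p : PMF ℕ) {m : ℕ} (i : Fin m → ℕ) :
    EuclideanSpace ℂ (Fin n) →L[ℂ] EuclideanSpace ℂ (Fin n) :=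
  (crossOpFin s w hs hw n).adjoint ∘L sampleOp p i ∘L crossOpFin s w hs hw n

/-- The empirical cross-term `ιₙ* U* Q S* P`, where `P` is the orthogonal projection onto the
orthogonal complement of the reconstruction space. -/
def empCross (p : PMF ℕ) {m : ℕ} (i : Fin m → ℕ) : H →L[ℂ] EuclideanSpace ℂ (Fin n) :=
  (crossOpFin s w hs hw n).adjoint ∘L sampleOp p i ∘L analysis s hs ∘L tailProj w n

/-- The constant `K = ‖W ιₙ Ĝ⁻¹ Ĉ‖`, with `Ĝ` the empirical Gram matrix and `Ĉ` the empirical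
cross-term. -/
def errorConst (p : PMF ℕ) {m : ℕ} (i : Fin m → ℕ) : ℝ :=
  ‖synthesis w hw ∘L incl n ∘L Ring.inverse (empGram s w hs hw n p i) ∘L
    empCross s w hs hw n p i‖

/-- The reconstruction `W ιₙ x` with coefficients `x`. -/
def recon (x : EuclideanSpace ℂ (Fin n)) : H := synthesis w hw (incl n x)

/-- The weighted least-squares objective
`∑ₜ |⟨W ιₙ x, s_{iₜ}⟩ - ⟨f, s_{iₜ}⟩|² / p_{iₜ}`. -/
def objective (p : PMF ℕ) {m : ℕ} (i : Fin m → ℕ) (f : H) (x : EuclideanSpace ℂ (Fin n)) : ℝ :=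
  ∑ t, (1 / (p (i t)).toReal) * ‖⟪s (i t), recon w hw n x⟫_ℂ - ⟪s (i t), f⟫_ℂ‖ ^ 2

/-- `x` solves the weighted least-squares problem. -/
def IsLeastSquaresSol (p : PMF ℕ) {m : ℕ} (i : Fin m → ℕ) (f : H)
    (x : EuclideanSpace ℂ (Fin n)) : Prop :=
  ∀ y, objective s w hw n p i f x ≤ objective s w hw n p i f y

end Operators

end

end StochasticGS

/-!
The least-squares problem has a unique solution exactly when the empirical Gram matrix `Ĝ` is
invertible, and this holds as soon as the sampled interaction vectors `v_{iₜ}` span `ℂⁿ`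
(`isUnit_empGram_of_span_eq_top`, `existsUnique_isLeastSquaresSol`,
`isUnit_empGram_of_existsUnique`). So only the spanning probability is needed, and no concentration
inequality for random matrices.

It is bounded by a coupon-collector argument. Write `κ = ‖Σ‖ ‖Σ⁻¹‖²`. The lower bound
`‖x‖² ≤ κ ∑ⱼ |⟨x, vⱼ⟩|²` (`norm_sq_le_mul_norm_crossOpFin_sq`) and `‖vⱼ‖² ≤ R pⱼ` show that a
random `vⱼ` lies outside a given subspace `V` with probability at least `codim V / (κ R)`
(`codim_le_mul_toMeasure`). Hence each independent sample multiplies the expected codimension of the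
span by at most `1 - 1 / (κ R)`, and after `m` samples Markov's inequality bounds the probability
that they do not span by `n exp (-m / (κ R))`
(`one_sub_finrank_mul_exp_le_measureReal_span_eq_top`), which the assumption on `m` makes at most
`δ`.

The error bound is deterministic (`norm_sub_recon_le`): the normal equations express the error
inside `𝒲ₙ` as `W ιₙ Ĝ⁻¹ Ĉ` applied to `P_{𝒲ₙ^⊥} f`, and Pythagoras' theorem adds the two parts.
-/

namespace StochasticGS

open scoped InnerProductSpace ENNReal
open MeasureTheory ProbabilityTheory Module

/-! ### Random samples span the space -/

section Spanning

variable {E : Type*} [NormedAddCommGroup E] [InnerProductSpace ℂ E] [FiniteDimensional ℂ E]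

/-- The codimension of `V`, as the dimension of its orthogonal complement. -/
noncomputable def codim (V : Submodule ℂ E) : ℕ := finrank ℂ Vᗮ

/-- The codimension of `V`, bounded by the chance that a sample falls outside `V`: sum the lower
frame bound `hlow` over an orthonormal basis of `Vᗮ`; by Bessel's inequality the index `j`
contributes at most `‖v j‖²`, and nothing at all if `v j ∈ V`. -/
theorem codim_le_mul_toMeasure (p : PMF ℕ) (v : ℕ → E) {R κ : ℝ} (hκ : 0 ≤ κ)
    (hv : ∀ j, ‖v j‖ ^ 2 ≤ R * (p j).toReal)
    (hsum : ∀ x, Summable fun j => ‖⟪v j, x⟫_ℂ‖ ^ 2)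
    (hlow : ∀ x, ‖x‖ ^ 2 ≤ κ * ∑' j, ‖⟪v j, x⟫_ℂ‖ ^ 2) (V : Submodule ℂ E) :
    (codim V : ℝ) ≤ κ * R * p.toMeasure.real {j | v j ∉ V} := by
  classical
  set b := stdOrthonormalBasis ℂ Vᗮ
  have hb : Orthonormal ℂ fun k => (b k : E) := b.orthonormal.comp_linearIsometry Vᗮ.subtypeₗᵢ
  have hp : Summable fun j => (p j).toReal := ENNReal.summable_toReal p.tsum_coe_ne_top
  have hreal : p.toMeasure.real {j | v j ∉ V}
      = ∑' j, {j | v j ∉ V}.indicator (fun j => (p j).toReal) j := by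
    rw [Measure.real, PMF.toMeasure_apply _ (MeasurableSet.of_discrete), ENNReal.tsum_toReal_eq]
    · refine tsum_congr fun j => ?_
      by_cases hj : v j ∈ V <;> simp [hj]
    · intro j
      by_cases hj : v j ∈ V <;> simp [hj, p.apply_ne_top]
  have hterm : ∀ j, ∑ k, ‖⟪v j, (b k : E)⟫_ℂ‖ ^ 2
      ≤ R * {j | v j ∉ V}.indicator (fun j => (p j).toReal) j := by
    intro j
    by_cases hj : v j ∈ V
    · have h0 : ∀ k, ⟪v j, (b k : E)⟫_ℂ = 0 := fun k => (b k).2 _ hj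
      simp [hj, h0]
    · have := hb.sum_inner_products_le (v j) (s := Finset.univ)
      simp only [norm_inner_symm (v j)]
      simpa [hj] using this.trans (hv j)
  calc (codim V : ℝ) = ∑ k, ‖(b k : E)‖ ^ 2 := by
        simp [hb.1, codim]
    _ ≤ ∑ k, κ * ∑' j, ‖⟪v j, (b k : E)⟫_ℂ‖ ^ 2 := Finset.sum_le_sum fun k _ => hlow _
    _ = κ * ∑' j, ∑ k, ‖⟪v j, (b k : E)⟫_ℂ‖ ^ 2 := by
        rw [← Finset.mul_sum, Summable.tsum_finsetSum fun k _ => hsum _]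
    _ ≤ κ * ∑' j, R * {j | v j ∉ V}.indicator (fun j => (p j).toReal) j := by
        refine mul_le_mul_of_nonneg_left ?_ hκ
        exact Summable.tsum_le_tsum hterm (summable_sum fun k _ => hsum _)
          ((hp.indicator _).mul_left R)
    _ = κ * R * p.toMeasure.real {j | v j ∉ V} := by rw [tsum_mul_left, hreal, mul_assoc]

theorem codim_sup_span_singleton_add_indicator_le (V : Submodule ℂ E) (x : E) :
    (codim (V ⊔ ℂ ∙ x) : ℝ≥0∞) + {y | y ∉ V}.indicator 1 x ≤ codim V := by
  by_cases hx : x ∈ V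
  · simp [hx]
  · have hlt : V < V ⊔ ℂ ∙ x := lt_of_le_of_ne le_sup_left fun h =>
      hx (h ▸ (le_sup_right : ℂ ∙ x ≤ V ⊔ ℂ ∙ x) (Submodule.mem_span_singleton_self x))
    have h1 := Submodule.finrank_lt_finrank_of_lt hlt
    have h2 := V.finrank_add_finrank_orthogonal
    have h3 := (V ⊔ ℂ ∙ x).finrank_add_finrank_orthogonal
    have h4 : codim (V ⊔ ℂ ∙ x) + 1 ≤ codim V := by
      rw [codim, codim]
      omega
    simpa [hx] using (by exact_mod_cast h4 :
      (codim (V ⊔ ℂ ∙ x) : ℝ≥0∞) + 1 ≤ codim V)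

/-- If every subspace is missed with probability at least `q` times its codimension, then adding
one sample shrinks the expected codimension by the factor `1 - q`. -/
theorem lintegral_codim_sup_span_singleton_le (p : PMF ℕ) (v : ℕ → E) {q : ℝ≥0∞}
    (hq : ∀ V : Submodule ℂ E, codim V * q ≤ p.toMeasure {j | v j ∉ V})
    (V : Submodule ℂ E) :
    ∫⁻ j, (codim (V ⊔ ℂ ∙ v j) : ℝ≥0∞) ∂p.toMeasure ≤ (1 - q) * codim V := by
  have h1 : ∫⁻ j, ((codim (V ⊔ ℂ ∙ v j) : ℝ≥0∞) + {j | v j ∉ V}.indicator 1 j) ∂p.toMeasure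
      ≤ codim V := by
    calc _ ≤ ∫⁻ _, (codim V : ℝ≥0∞) ∂p.toMeasure := lintegral_mono fun j =>
          codim_sup_span_singleton_add_indicator_le V (v j)
      _ = _ := by simp
  rw [lintegral_add_left Measurable.of_discrete, lintegral_indicator_one MeasurableSet.of_discrete]
    at h1
  have h2 := (add_le_add_right (hq V) _).trans h1
  rw [ENNReal.sub_mul fun _ _ => ENNReal.natCast_ne_top _, one_mul, mul_comm]
  exact ENNReal.le_sub_of_add_le_right
    (ne_top_of_le_ne_top (measure_ne_top p.toMeasure _) (hq V)) h2

/-- The expected codimension left after `m` independent samples, starting from a subspace `V`. The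
induction peels off the first sample, which is why `V` has to vary. -/
theorem lintegral_pi_codim_sup_span_range_le (p : PMF ℕ) (v : ℕ → E) {q : ℝ≥0∞}
    (hq : ∀ V : Submodule ℂ E, codim V * q ≤ p.toMeasure {j | v j ∉ V}) (m : ℕ)
    (V : Submodule ℂ E) :
    ∫⁻ i, (codim (V ⊔ Submodule.span ℂ (Set.range fun t => v (i t))) : ℝ≥0∞)
      ∂Measure.pi (fun _ : Fin m => p.toMeasure) ≤ (1 - q) ^ m * codim V := by
  induction m generalizing V with
  | zero => simp [lintegral_const]
  | succ m ih =>
    have hmp := (measurePreserving_piFinSuccAbove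
      (fun _ : Fin (m + 1) => p.toMeasure) 0).symm
    rw [← hmp.lintegral_comp Measurable.of_discrete,
      lintegral_prod _ Measurable.of_discrete.aemeasurable]
    have hspan : ∀ (j : ℕ) (i : Fin m → ℕ),
        V ⊔ Submodule.span ℂ (Set.range fun t =>
          v ((MeasurableEquiv.piFinSuccAbove (fun _ => ℕ) 0).symm (j, i) t))
        = (V ⊔ ℂ ∙ v j) ⊔ Submodule.span ℂ (Set.range fun t => v (i t)) := by
      intro j i
      have : (fun t => v ((MeasurableEquiv.piFinSuccAbove (fun _ => ℕ) 0).symm (j, i) t))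
          = Fin.cons (v j) fun t => v (i t) := by
        funext t
        refine Fin.cases ?_ (fun t => ?_) t <;>
          simp [MeasurableEquiv.piFinSuccAbove, Fin.insertNthEquiv]
      rw [this, Fin.range_cons, Submodule.span_insert, sup_assoc]
    simp only [hspan]
    calc _ ≤ ∫⁻ j, (1 - q) ^ m * (codim (V ⊔ ℂ ∙ v j) : ℝ≥0∞) ∂p.toMeasure :=
          lintegral_mono fun j => ih _
      _ = (1 - q) ^ m * ∫⁻ j, (codim (V ⊔ ℂ ∙ v j) : ℝ≥0∞) ∂p.toMeasure :=
          lintegral_const_mul _ Measurable.of_discrete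
      _ ≤ (1 - q) ^ m * ((1 - q) * codim V) := by
          gcongr
          exact lintegral_codim_sup_span_singleton_le p v hq V
      _ = _ := by rw [pow_succ, mul_assoc]

/-- Independent samples span the space up to an exponentially small probability. The codimension
of their span is a natural number, so by Markov's inequality it vanishes except with probability
at most its expectation. -/
theorem one_sub_finrank_mul_exp_le_measureReal_span_eq_top (p : PMF ℕ) (v : ℕ → E) {R κ : ℝ}
    (hκR : 0 < κ * R) (hκ : 0 ≤ κ)
    (hv : ∀ j, ‖v j‖ ^ 2 ≤ R * (p j).toReal)
    (hsum : ∀ x, Summable fun j => ‖⟪v j, x⟫_ℂ‖ ^ 2)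
    (hlow : ∀ x, ‖x‖ ^ 2 ≤ κ * ∑' j, ‖⟪v j, x⟫_ℂ‖ ^ 2) {m : ℕ}
    {Ω : Type*} [MeasurableSpace Ω] (P : Measure Ω) [IsProbabilityMeasure P]
    (i : Fin m → Ω → ℕ) (hi_meas : ∀ t, Measurable (i t)) (hi_indep : iIndepFun i P)
    (hi_law : ∀ t, P.map (i t) = p.toMeasure) :
    1 - finrank ℂ E * Real.exp (-(m / (κ * R)))
      ≤ P.real {ω | Submodule.span ℂ (Set.range fun t => v (i t ω)) = ⊤} := by
  set q : ℝ≥0∞ := ENNReal.ofReal (κ * R)⁻¹ with hqdef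
  have hq : ∀ V : Submodule ℂ E, codim V * q ≤ p.toMeasure {j | v j ∉ V} := by
    intro V
    have h := codim_le_mul_toMeasure p v hκ hv hsum hlow V
    rw [← ENNReal.ofReal_toReal (measure_ne_top p.toMeasure {j | v j ∉ V}), hqdef,
      ← ENNReal.ofReal_natCast, ← ENNReal.ofReal_mul (by positivity)]
    refine ENNReal.ofReal_le_ofReal ?_
    rw [← div_eq_mul_inv, div_le_iff₀ hκR, mul_comm]
    exact h
  have hmeas : Measurable fun ω t => i t ω := measurable_pi_lambda _ hi_meas
  have hlaw : P.map (fun ω t => i t ω) = Measure.pi fun _ : Fin m => p.toMeasure := by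
    rw [(iIndepFun_iff_map_fun_eq_pi_map fun t => (hi_meas t).aemeasurable).1 hi_indep]
    simp only [hi_law]
  have hexp := lintegral_pi_codim_sup_span_range_le p v hq m ⊥
  rw [← hlaw, lintegral_map Measurable.of_discrete hmeas] at hexp
  have hbot : codim (⊥ : Submodule ℂ E) = finrank ℂ E := by
    rw [codim, Submodule.bot_orthogonal_eq_top, finrank_top]
  simp only [bot_sup_eq, hbot] at hexp
  set G : Set Ω := {ω | Submodule.span ℂ (Set.range fun t => v (i t ω)) = ⊤} with hG
  have hGm : MeasurableSet G :=
    hmeas (MeasurableSet.of_discrete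
      (s := {i : Fin m → ℕ | Submodule.span ℂ (Set.range fun t => v (i t)) = ⊤}))
  have hbad : P Gᶜ ≤ (1 - q) ^ m * finrank ℂ E := by
    refine le_trans ?_ hexp
    rw [← lintegral_indicator_one hGm.compl]
    refine lintegral_mono fun ω => ?_
    by_cases hω : ω ∈ G
    · simp [hω]
    · have : codim (Submodule.span ℂ (Set.range fun t => v (i t ω))) ≠ 0 := by
        rw [codim, Ne, Submodule.finrank_eq_zero, Submodule.orthogonal_eq_bot_iff]
        exact hω
      simpa [hω] using (by exact_mod_cast Nat.one_le_iff_ne_zero.2 this : (1 : ℝ≥0∞) ≤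
        codim (Submodule.span ℂ (Set.range fun t => v (i t ω))))
  have hpow : (1 - q) ^ m * finrank ℂ E
      ≤ ENNReal.ofReal (finrank ℂ E * Real.exp (-(m / (κ * R)))) := by
    have h1 : 1 - q ≤ ENNReal.ofReal (Real.exp (-(κ * R)⁻¹)) := by
      rw [hqdef, ← ENNReal.ofReal_one, ← ENNReal.ofReal_sub _ (by positivity)]
      exact ENNReal.ofReal_le_ofReal (Real.one_sub_le_exp_neg _)
    calc (1 - q) ^ m * finrank ℂ E
        ≤ ENNReal.ofReal (Real.exp (-(κ * R)⁻¹)) ^ m * finrank ℂ E := by gcongr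
      _ = _ := by
        rw [← ENNReal.ofReal_pow (by positivity), ← ENNReal.ofReal_natCast (n := finrank ℂ E),
          ← ENNReal.ofReal_mul (by positivity), ← Real.exp_nat_mul, mul_comm, mul_neg,
          ← div_eq_mul_inv]
  have hreal : P.real Gᶜ ≤ finrank ℂ E * Real.exp (-(m / (κ * R))) :=
    ENNReal.toReal_le_of_le_ofReal (by positivity) (hbad.trans hpow)
  rw [probReal_compl_eq_one_sub hGm] at hreal
  linarith

end Spanning

/-! ### The sampling operators in coordinates -/

section LeastSquares

variable {H : Type*} [NormedAddCommGroup H] [InnerProductSpace ℂ H] [CompleteSpace H]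
variable (s w : ℕ → H) (hs : IsBesselSeq s) (hw : IsBesselSeq w) (n : ℕ)

theorem crossOpFin_apply (x : EuclideanSpace ℂ (Fin n)) (j : ℕ) :
    crossOpFin s w hs hw n x j = ⟪s j, recon w hw n x⟫_ℂ := rfl

theorem inner_interaction (x : EuclideanSpace ℂ (Fin n)) (j : ℕ) :
    ⟪interaction s w hs hw n j, x⟫_ℂ = ⟪s j, recon w hw n x⟫_ℂ := by
  rw [interaction, ContinuousLinearMap.adjoint_inner_left, lp.inner_single_left, crossOpFin_apply]
  simp

theorem hasSum_norm_inner_interaction_sq (x : EuclideanSpace ℂ (Fin n)) :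
    HasSum (fun j => ‖⟪interaction s w hs hw n j, x⟫_ℂ‖ ^ 2) (‖crossOpFin s w hs hw n x‖ ^ 2) := by
  have h := lp.hasSum_norm (p := 2) (by norm_num) (crossOpFin s w hs hw n x)
  simpa [crossOpFin_apply, inner_interaction] using h

theorem recon_eq_sum (x : EuclideanSpace ℂ (Fin n)) : recon w hw n x = ∑ k : Fin n, x k • w k := by
  have h := hasSum_synthesis w hw (incl n x)
  refine h.unique ?_
  have h2 : HasSum (fun k => incl n x k • w k) _ := hasSum_sum_of_ne_finset_zero
    (s := Finset.range n)
    (fun k hk => by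
      rw [incl_apply, dif_neg (by simpa using hk), zero_smul])
  convert h2 using 1
  rw [Finset.sum_range]
  exact Finset.sum_congr rfl fun k _ => by simp [incl_apply]

theorem exists_recon_eq {g : H} (hg : g ∈ reconSpace w n) : ∃ c, recon w hw n c = g := by
  obtain ⟨c, hc⟩ := (Submodule.mem_span_range_iff_exists_fun ℂ).1 hg
  exact ⟨WithLp.toLp 2 c, by rw [recon_eq_sum]; exact hc⟩

theorem recon_mem (x : EuclideanSpace ℂ (Fin n)) : recon w hw n x ∈ reconSpace w n := by
  rw [recon_eq_sum]
  exact Submodule.sum_mem _ fun k _ => Submodule.smul_mem _ _ (Submodule.subset_span ⟨k, rfl⟩)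

theorem recon_sub (x y : EuclideanSpace ℂ (Fin n)) :
    recon w hw n (x - y) = recon w hw n x - recon w hw n y := by
  simp [recon]

variable {s w n}

theorem eq_zero_of_recon_eq_zero (hw' : IsRieszSeq w) {x : EuclideanSpace ℂ (Fin n)}
    (hx : recon w hw n x = 0) : x = 0 := by
  obtain ⟨C, D, hC, -, h⟩ := hw'
  have h1 := (h (incl n x)).2.1
  rw [(hasSum_synthesis w hw (incl n x)).tsum_eq] at h1
  rw [recon] at hx
  rw [hx, norm_zero] at h1
  have h2 : ‖incl n x‖ = 0 := by
    have : ‖incl n x‖ ^ 2 ≤ 0 := by nlinarith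
    exact pow_eq_zero_iff two_ne_zero |>.1 (le_antisymm this (sq_nonneg _))
  have h3 := norm_eq_zero.1 h2
  ext k
  have := incl_apply n x k
  rw [h3] at this
  simpa using this.symm

theorem crossOpFin_injective (hw' : IsRieszSeq w) (hWS : closedSpan w ⊓ (closedSpan s)ᗮ = ⊥) :
    Function.Injective (crossOpFin s w hs hw n) := by
  rw [injective_iff_map_eq_zero]
  intro x hx
  refine eq_zero_of_recon_eq_zero hw hw' ?_
  rw [← Submodule.mem_bot ℂ, ← hWS]
  refine ⟨?_, ?_⟩
  · refine Submodule.le_topologicalClosure _ (Submodule.span_mono ?_ (recon_mem w hw n x))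
    rintro _ ⟨k, rfl⟩
    exact ⟨k, rfl⟩
  · rw [closedSpan, Submodule.orthogonal_closure, SetLike.mem_coe, Submodule.mem_orthogonal]
    intro u hu
    induction hu using Submodule.span_induction with
    | mem u hu =>
      obtain ⟨j, rfl⟩ := hu
      rw [← crossOpFin_apply s w hs hw, hx]
      rfl
    | zero => simp
    | add u v _ _ hu hv => rw [inner_add_left, hu, hv, add_zero]
    | smul c u _ hu => rw [inner_smul_left, hu, mul_zero]

theorem isUnit_of_injective {E : Type*} [NormedAddCommGroup E] [NormedSpace ℂ E]
    [FiniteDimensional ℂ E] {A : E →L[ℂ] E} (hA : Function.Injective A) : IsUnit A := by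
  have : CompleteSpace E := FiniteDimensional.complete ℂ E
  rw [ContinuousLinearMap.isUnit_iff_bijective]
  exact ⟨hA, LinearMap.surjective_of_injective (f := (A : E →ₗ[ℂ] E)) hA⟩

theorem gram_injective (hw' : IsRieszSeq w) (hWS : closedSpan w ⊓ (closedSpan s)ᗮ = ⊥) :
    Function.Injective (gram s w hs hw n) := by
  rw [injective_iff_map_eq_zero]
  intro x hx
  refine (injective_iff_map_eq_zero _).1 (crossOpFin_injective hs hw hw' hWS) x ?_
  rw [← norm_eq_zero, ← sq_eq_zero_iff, ContinuousLinearMap.apply_norm_sq_eq_inner_adjoint_right]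
  change RCLike.re ⟪x, gram s w hs hw n x⟫_ℂ = 0
  rw [hx, inner_zero_right, map_zero]

/-- Since `‖Σ x‖ ≤ ‖U ιₙ‖ ‖U ιₙ x‖` and `‖U ιₙ‖² = ‖Σ‖`, invertibility of `Σ` makes `U ιₙ` bounded
below. -/
theorem norm_sq_le_mul_norm_crossOpFin_sq (hG : IsUnit (gram s w hs hw n))
    (x : EuclideanSpace ℂ (Fin n)) :
    ‖x‖ ^ 2 ≤ ‖gram s w hs hw n‖ * ‖Ring.inverse (gram s w hs hw n)‖ ^ 2
      * ‖crossOpFin s w hs hw n x‖ ^ 2 := by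
  set T := crossOpFin s w hs hw n
  set A := Ring.inverse (gram s w hs hw n)
  have h1 : A (gram s w hs hw n x) = x := by
    rw [← mul_apply_eq_comp, Ring.inverse_mul_cancel _ hG, one_apply_eq_self]
  have h2 : ‖gram s w hs hw n x‖ ≤ ‖T‖ * ‖T x‖ := by
    have := T.adjoint.le_opNorm (T x)
    rwa [LinearIsometryEquiv.norm_map] at this
  have h3 : ‖gram s w hs hw n‖ = ‖T‖ * ‖T‖ := T.norm_adjoint_comp_self
  calc ‖x‖ ^ 2 = ‖A (gram s w hs hw n x)‖ ^ 2 := by rw [h1]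
    _ ≤ (‖A‖ * (‖T‖ * ‖T x‖)) ^ 2 := by
        gcongr
        exact (A.le_opNorm _).trans (by gcongr)
    _ = _ := by rw [h3]; ring

/-! ### The empirical Gram matrix and the least-squares problem -/

variable (p : PMF ℕ) {m : ℕ} (i : Fin m → ℕ)

theorem inner_sampleOp (z r : SeqSpace) :
    ⟪z, sampleOp p i r⟫_ℂ
      = (m : ℂ)⁻¹ * ∑ t, ((p (i t)).toReal : ℂ)⁻¹ * (⟪z (i t), r (i t)⟫_ℂ) := by
  simp only [sampleOp, _root_.smul_apply, _root_.sum_apply,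
    InnerProductSpace.rankOne_apply, inner_smul_right, inner_sum, lp.inner_single_left,
    lp.inner_single_right]
  congr 1
  refine Finset.sum_congr rfl fun t _ => ?_
  simp [mul_comm]

theorem inner_empGram (x y : EuclideanSpace ℂ (Fin n)) :
    ⟪y, empGram s w hs hw n p i x⟫_ℂ = (m : ℂ)⁻¹ * ∑ t, ((p (i t)).toReal : ℂ)⁻¹ *
      ⟪⟪s (i t), recon w hw n y⟫_ℂ, ⟪s (i t), recon w hw n x⟫_ℂ⟫_ℂ := by
  rw [empGram, ContinuousLinearMap.comp_apply, ContinuousLinearMap.adjoint_inner_right,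
    ContinuousLinearMap.comp_apply, inner_sampleOp]
  rfl

variable {p i}

/-- A vector in the kernel of the empirical Gram matrix is orthogonal to every sampled interaction
vector. An index of probability zero has weight `0⁻¹ = 0` in the Gram matrix, but there the
interaction vector itself vanishes. -/
theorem inner_interaction_eq_zero_of_empGram_eq_zero
    (hsupp : ∀ j, interaction s w hs hw n j ≠ 0 → p j ≠ 0)
    {y : EuclideanSpace ℂ (Fin n)} (hy : empGram s w hs hw n p i y = 0) (t : Fin m) :
    ⟪interaction s w hs hw n (i t), y⟫_ℂ = 0 := by
  by_cases hv : interaction s w hs hw n (i t) = 0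
  · rw [hv, inner_zero_left]
  have hp : 0 < (p (i t)).toReal := ENNReal.toReal_pos (hsupp _ hv) (p.apply_ne_top _)
  have hm : (m : ℂ)⁻¹ ≠ 0 := by
    have := t.pos
    simp; omega
  have h := inner_empGram hs hw p i y y
  rw [hy, inner_zero_right, eq_comm, mul_eq_zero, or_iff_right hm] at h
  have h' : ∑ t, (p (i t)).toReal⁻¹ * ‖⟪s (i t), recon w hw n y⟫_ℂ‖ ^ 2 = 0 := by
    simp only [inner_self_eq_norm_sq_to_K] at h
    have h'' : ((∑ t, (p (i t)).toReal⁻¹ * ‖⟪s (i t), recon w hw n y⟫_ℂ‖ ^ 2 : ℝ) : ℂ) = 0 := by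
      push_cast
      exact h
    exact_mod_cast h''
  have h2 := (Finset.sum_eq_zero_iff_of_nonneg fun t _ => by positivity).1 h' t (Finset.mem_univ t)
  rw [inner_interaction]
  simpa [hp.ne'] using h2

theorem isUnit_empGram_of_span_eq_top
    (hsupp : ∀ j, interaction s w hs hw n j ≠ 0 → p j ≠ 0)
    (hspan : Submodule.span ℂ (Set.range fun t => interaction s w hs hw n (i t)) = ⊤) :
    IsUnit (empGram s w hs hw n p i) := by
  refine isUnit_of_injective ((injective_iff_map_eq_zero _).2 fun y hy => ?_)
  rw [← Submodule.mem_bot ℂ, ← Submodule.top_orthogonal_eq_bot, ← hspan, Submodule.mem_orthogonal]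
  intro u hu
  induction hu using Submodule.span_induction with
  | mem u hu =>
    obtain ⟨t, rfl⟩ := hu
    exact inner_interaction_eq_zero_of_empGram_eq_zero hs hw hsupp hy t
  | zero => simp
  | add u v _ _ hu hv => rw [inner_add_left, hu, hv, add_zero]
  | smul c u _ hu => rw [inner_smul_left, hu, mul_zero]

/-- A direction in the kernel of the empirical Gram matrix does not change the objective, so a
unique minimizer leaves no such direction. This includes `m = 0`, where every `x` is a solution. -/
theorem isUnit_empGram_of_existsUnique
    (hsupp : ∀ j, interaction s w hs hw n j ≠ 0 → p j ≠ 0) {f : H}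
    (h : ∃! x, IsLeastSquaresSol s w hw n p i f x) : IsUnit (empGram s w hs hw n p i) := by
  refine isUnit_of_injective ((injective_iff_map_eq_zero _).2 fun y hy => ?_)
  obtain ⟨x, hx, hux⟩ := h
  have h0 : ∀ t, ⟪s (i t), recon w hw n y⟫_ℂ = 0 := fun t => by
    rw [← inner_interaction s w hs hw]
    exact inner_interaction_eq_zero_of_empGram_eq_zero hs hw hsupp hy t
  have h1 : objective s w hw n p i f (x - y) = objective s w hw n p i f x := by
    simp only [objective, recon_sub, inner_sub_right, h0, sub_zero]
  have h2 := hux (x - y) fun z => h1.le.trans (hx z)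
  simpa using h2

variable (p i) in
/-- Pythagoras for the objective, around a solution of the normal equations. -/
theorem objective_eq_add {f : H} {x : EuclideanSpace ℂ (Fin n)}
    (hx : empGram s w hs hw n p i x
      = (crossOpFin s w hs hw n).adjoint (sampleOp p i (analysis s hs f)))
    (y : EuclideanSpace ℂ (Fin n)) :
    objective s w hw n p i f y = objective s w hw n p i f x
      + ∑ t, (p (i t)).toReal⁻¹ * ‖⟪s (i t), recon w hw n (y - x)⟫_ℂ‖ ^ 2 := by
  rcases Nat.eq_zero_or_pos m with rfl | hm
  · simp [objective]
  have hm' : (m : ℂ)⁻¹ ≠ 0 := by simp; omega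
  have h : ∑ t, ((p (i t)).toReal : ℂ)⁻¹ * ⟪⟪s (i t), recon w hw n (y - x)⟫_ℂ,
      ⟪s (i t), recon w hw n x⟫_ℂ - ⟪s (i t), f⟫_ℂ⟫_ℂ = 0 := by
    have h1 := inner_empGram hs hw p i x (y - x)
    rw [hx, ContinuousLinearMap.adjoint_inner_right, inner_sampleOp] at h1
    have h2 := mul_left_cancel₀ hm' h1
    simp only [analysis_apply, crossOpFin_apply] at h2
    simp only [inner_sub_right _ (⟪s _, recon w hw n x⟫_ℂ), mul_sub, Finset.sum_sub_distrib]
    rw [sub_eq_zero]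
    exact h2.symm
  have hre := congrArg Complex.re h
  rw [Complex.re_sum] at hre
  have hre' : ∑ t, (p (i t)).toReal⁻¹ * (⟪⟪s (i t), recon w hw n (y - x)⟫_ℂ,
      ⟪s (i t), recon w hw n x⟫_ℂ - ⟪s (i t), f⟫_ℂ⟫_ℂ).re = 0 := by
    rw [← Complex.zero_re, ← hre]
    refine Finset.sum_congr rfl fun t _ => ?_
    rw [← Complex.ofReal_inv, Complex.re_ofReal_mul]
  have hterm : ∀ t, (1 / (p (i t)).toReal) * ‖⟪s (i t), recon w hw n y⟫_ℂ - ⟪s (i t), f⟫_ℂ‖ ^ 2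
      = (1 / (p (i t)).toReal) * ‖⟪s (i t), recon w hw n x⟫_ℂ - ⟪s (i t), f⟫_ℂ‖ ^ 2
        + (p (i t)).toReal⁻¹ * ‖⟪s (i t), recon w hw n (y - x)⟫_ℂ‖ ^ 2
        + 2 * ((p (i t)).toReal⁻¹ * (⟪⟪s (i t), recon w hw n (y - x)⟫_ℂ,
      ⟪s (i t), recon w hw n x⟫_ℂ - ⟪s (i t), f⟫_ℂ⟫_ℂ).re) := by
    intro t
    have h1 : ⟪s (i t), recon w hw n y⟫_ℂ - ⟪s (i t), f⟫_ℂ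
        = ⟪s (i t), recon w hw n (y - x)⟫_ℂ
          + (⟪s (i t), recon w hw n x⟫_ℂ - ⟪s (i t), f⟫_ℂ) := by
      rw [recon_sub, inner_sub_right]; ring
    rw [h1, norm_add_sq (𝕜 := ℂ)]
    simp only [RCLike.re_to_complex]
    ring
  simp only [objective, hterm, Finset.sum_add_distrib, ← Finset.mul_sum, hre']
  ring

theorem isLeastSquaresSol_of_empGram_eq {f : H} {x : EuclideanSpace ℂ (Fin n)}
    (hx : empGram s w hs hw n p i x
      = (crossOpFin s w hs hw n).adjoint (sampleOp p i (analysis s hs f))) :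
    IsLeastSquaresSol s w hw n p i f x := by
  intro y
  rw [objective_eq_add hs hw p i hx y]
  exact le_add_of_nonneg_right (Finset.sum_nonneg fun t _ => by positivity)

theorem isLeastSquaresSol_iff (hG : IsUnit (empGram s w hs hw n p i)) {f : H}
    {x : EuclideanSpace ℂ (Fin n)} :
    IsLeastSquaresSol s w hw n p i f x ↔ empGram s w hs hw n p i x
      = (crossOpFin s w hs hw n).adjoint (sampleOp p i (analysis s hs f)) := by
  refine ⟨fun hx => ?_, isLeastSquaresSol_of_empGram_eq hs hw⟩
  obtain ⟨hinj, hsurj⟩ := ContinuousLinearMap.isUnit_iff_bijective.1 hG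
  obtain ⟨z, hz⟩ := hsurj ((crossOpFin s w hs hw n).adjoint (sampleOp p i (analysis s hs f)))
  have h1 := objective_eq_add hs hw p i hz x
  have h2 : ∑ t, (p (i t)).toReal⁻¹ * ‖⟪s (i t), recon w hw n (x - z)⟫_ℂ‖ ^ 2 = 0 :=
    le_antisymm (by linarith [hx z]) (Finset.sum_nonneg fun t _ => by positivity)
  have h3 : empGram s w hs hw n p i (x - z) = 0 := by
    rw [← inner_self_eq_zero (𝕜 := ℂ), inner_empGram, Finset.sum_eq_zero, mul_zero]
    intro t ht
    have h4 := (Finset.sum_eq_zero_iff_of_nonneg fun t _ => by positivity).1 h2 t ht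
    rcases mul_eq_zero.1 h4 with h5 | h5
    · rw [← Complex.ofReal_inv, h5, Complex.ofReal_zero, zero_mul]
    · rw [norm_eq_zero.1 (pow_eq_zero_iff two_ne_zero |>.1 h5), inner_zero_right, mul_zero]
  rw [sub_eq_zero.1 (hinj.eq_iff' (map_zero _) |>.1 h3), hz]

theorem existsUnique_isLeastSquaresSol (hG : IsUnit (empGram s w hs hw n p i)) (f : H) :
    ∃! x, IsLeastSquaresSol s w hw n p i f x := by
  simp only [isLeastSquaresSol_iff hs hw hG]
  exact (ContinuousLinearMap.isUnit_iff_bijective.1 hG).existsUnique _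

/-- With `P_{𝒲ₙ} f = W ιₙ c` and `g = P_{𝒲ₙ^⊥} f`, the normal equations give
`x - c = Ĝ⁻¹ Ĉ g`, and `g` is orthogonal to `W ιₙ (x - c)`. -/
theorem norm_sub_recon_le (hG : IsUnit (empGram s w hs hw n p i)) {f : H}
    {x : EuclideanSpace ℂ (Fin n)} (hx : IsLeastSquaresSol s w hw n p i f x) :
    ‖f - recon w hw n x‖ ≤ ‖tailProj w n f‖ *
      (1 + errorConst s w hs hw n p i ^ 2) ^ (1 / 2 : ℝ) := by
  rw [isLeastSquaresSol_iff hs hw hG] at hx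
  have : FiniteDimensional ℂ (reconSpace w n) :=
    FiniteDimensional.span_of_finite ℂ (Set.finite_range _)
  set G := empGram s w hs hw n p i with hGdef
  set g := tailProj w n f with hg
  obtain ⟨c, hc⟩ := exists_recon_eq w hw n
    (Submodule.starProjection_apply_mem (reconSpace w n) f)
  have hdecomp : f = recon w hw n c + g := by
    rw [hc, hg, tailProj, Submodule.starProjection_orthogonal_val]
    abel
  have hgg : tailProj w n g = g := by
    rw [hg, tailProj]
    exact Submodule.starProjection_eq_self_iff.2 (Submodule.starProjection_apply_mem _ _)
  have hcross : G (x - c) = empCross s w hs hw n p i g := by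
    rw [map_sub, hx, hdecomp]
    simp only [map_add, empCross, ContinuousLinearMap.comp_apply, hgg]
    rw [add_sub_assoc, add_comm, sub_add_eq_add_sub, add_sub_assoc]
    refine add_eq_left.2 (sub_eq_zero.2 rfl)
  have hxc : x - c = Ring.inverse G (empCross s w hs hw n p i g) := by
    rw [← hcross, ← mul_apply_eq_comp, Ring.inverse_mul_cancel _ hG,
      one_apply_eq_self]
  have hbound : ‖recon w hw n (x - c)‖ ≤ errorConst s w hs hw n p i * ‖g‖ := by
    rw [hxc]
    exact ContinuousLinearMap.le_opNorm (synthesis w hw ∘L incl n ∘L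
      Ring.inverse (empGram s w hs hw n p i) ∘L empCross s w hs hw n p i) g
  have hres : f - recon w hw n x = g - recon w hw n (x - c) := by
    rw [recon_sub]
    nth_rewrite 1 [hdecomp]
    abel
  have horth : ⟪g, recon w hw n (x - c)⟫_ℂ = 0 :=
    Submodule.inner_left_of_mem_orthogonal (recon_mem w hw n _)
      (Submodule.starProjection_apply_mem _ _)
  have hsq : ‖f - recon w hw n x‖ ^ 2 ≤ ‖g‖ ^ 2 * (1 + errorConst s w hs hw n p i ^ 2) := by
    rw [hres, norm_sub_sq (𝕜 := ℂ), horth]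
    have : ‖recon w hw n (x - c)‖ ^ 2 ≤ (errorConst s w hs hw n p i * ‖g‖) ^ 2 := by gcongr
    simp only [map_zero, mul_zero, sub_zero]
    nlinarith
  rw [← Real.sqrt_eq_rpow]
  calc ‖f - recon w hw n x‖ ≤ √(‖g‖ ^ 2 * (1 + errorConst s w hs hw n p i ^ 2)) :=
        Real.le_sqrt_of_sq_le hsq
    _ = _ := by rw [Real.sqrt_mul (sq_nonneg _), Real.sqrt_sq (norm_nonneg _)]

end LeastSquares
end StochasticGS

/-! ### Probability of recovery and error bound -/

theorem theorem3p1
    {H : Type*} [NormedAddCommGroup H] [InnerProductSpace ℂ H] [CompleteSpace H]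
    [TopologicalSpace.SeparableSpace H]
    (s w : ℕ → H) (hs : StochasticGS.IsFrameSeq s) (hw : StochasticGS.IsRieszSeq w)
    (hWS : StochasticGS.closedSpan w ⊓ (StochasticGS.closedSpan s)ᗮ = ⊥)
    (n : ℕ) (hn : 1 ≤ n) (p : PMF ℕ)
    (hR : BddAbove (Set.range
      (StochasticGS.coherenceRatio s w hs.isBesselSeq hw.isBesselSeq n p)))
    (hsupp : ∀ j, StochasticGS.interaction s w hs.isBesselSeq hw.isBesselSeq n j ≠ 0 → p j ≠ 0)
    (f : H) (m : ℕ)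
    {Ω : Type*} [MeasurableSpace Ω] (P : MeasureTheory.Measure Ω)
    [MeasureTheory.IsProbabilityMeasure P]
    (i : Fin m → Ω → ℕ) (hi_meas : ∀ t, Measurable (i t))
    (hi_indep : ProbabilityTheory.iIndepFun i P)
    (hi_law : ∀ t, P.map (i t) = p.toMeasure)
    (δ : ℝ) (hδ0 : 0 < δ) (hδ1 : δ < 1)
    (hm : 8 / 3 * StochasticGS.coherence s w hs.isBesselSeq hw.isBesselSeq n p
        * ‖StochasticGS.gram s w hs.isBesselSeq hw.isBesselSeq n‖
        * ‖Ring.inverse (StochasticGS.gram s w hs.isBesselSeq hw.isBesselSeq n)‖ ^ 2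
        * Real.log (2 * n / δ) ≤ m) :
    1 - δ ≤ P.real {ω | ∃! x, StochasticGS.IsLeastSquaresSol s w hw.isBesselSeq n p
        (fun t => i t ω) f x} ∧
    ∀ᵐ ω ∂P, (∃! x, StochasticGS.IsLeastSquaresSol s w hw.isBesselSeq n p
        (fun t => i t ω) f x) →
      IsUnit (StochasticGS.empGram s w hs.isBesselSeq hw.isBesselSeq n p (fun t => i t ω)) ∧
      ∀ x, StochasticGS.IsLeastSquaresSol s w hw.isBesselSeq n p (fun t => i t ω) f x →
        ‖f - StochasticGS.recon w hw.isBesselSeq n x‖ ≤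
          ‖StochasticGS.tailProj w n f‖ *
            (1 + StochasticGS.errorConst s w hs.isBesselSeq hw.isBesselSeq n p
              (fun t => i t ω) ^ 2) ^ (1 / 2 : ℝ) := by
  have hS := hs.isBesselSeq
  have hW := hw.isBesselSeq
  refine ⟨?_, Filter.Eventually.of_forall fun ω hω => ?_⟩
  swap
  · have hG := StochasticGS.isUnit_empGram_of_existsUnique hS hW hsupp hω
    exact ⟨hG, fun x hx => StochasticGS.norm_sub_recon_le hS hW hG hx⟩
  -- `κ R` is exactly the coefficient of `log (2 n / δ)` in `hm`, up to the factor `8 / 3`.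
  set R := StochasticGS.coherence s w hS hW n p with hRdef
  set κ := ‖StochasticGS.gram s w hS hW n‖ * ‖Ring.inverse (StochasticGS.gram s w hS hW n)‖ ^ 2
    with hκdef
  have hgram : IsUnit (StochasticGS.gram s w hS hW n) :=
    StochasticGS.isUnit_of_injective (StochasticGS.gram_injective hS hW hw hWS)
  have : Nonempty (Fin n) := ⟨⟨0, hn⟩⟩
  have hκ : 0 < κ := by
    have h1 : StochasticGS.gram s w hS hW n ≠ 0 := hgram.ne_zero
    have h2 : Ring.inverse (StochasticGS.gram s w hS hW n) ≠ 0 := (hgram.ringInverse).ne_zero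
    positivity
  have hv : ∀ j, ‖StochasticGS.interaction s w hS hW n j‖ ^ 2 ≤ R * (p j).toReal := by
    intro j
    by_cases hj : StochasticGS.interaction s w hS hW n j = 0
    · have hR0 : 0 ≤ R := Real.iSup_nonneg fun _ =>
        div_nonneg (sq_nonneg _) ENNReal.toReal_nonneg
      rw [hj, norm_zero, zero_pow two_ne_zero]
      exact mul_nonneg hR0 ENNReal.toReal_nonneg
    · have hp := hsupp j hj
      have h1 : StochasticGS.coherenceRatio s w hS hW n p ⟨j, (p.mem_support_iff j).2 hp⟩ ≤ R :=
        le_ciSup hR _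
      exact (div_le_iff₀ (ENNReal.toReal_pos hp (p.apply_ne_top j))).1 h1
  have hRpos : 0 < R := by
    by_contra hR0
    have hzero : ∀ j, StochasticGS.interaction s w hS hW n j = 0 := fun j => by
      have h1 := hv j
      have h2 : R * (p j).toReal ≤ 0 :=
        mul_nonpos_of_nonpos_of_nonneg (not_lt.1 hR0) ENNReal.toReal_nonneg
      exact norm_eq_zero.1 (pow_eq_zero_iff two_ne_zero |>.1
        (le_antisymm (h1.trans h2) (sq_nonneg _)))
    obtain ⟨x, hx⟩ := exists_ne (0 : EuclideanSpace ℂ (Fin n))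
    have h1 := StochasticGS.norm_sq_le_mul_norm_crossOpFin_sq hS hW hgram x
    rw [← (StochasticGS.hasSum_norm_inner_interaction_sq s w hS hW n x).tsum_eq] at h1
    simp only [hzero, inner_zero_left, norm_zero, ne_eq, OfNat.ofNat_ne_zero, not_false_eq_true,
      zero_pow, tsum_zero, mul_zero] at h1
    exact hx (norm_eq_zero.1 (pow_eq_zero_iff two_ne_zero |>.1 (le_antisymm h1 (sq_nonneg _))))
  have hspan := StochasticGS.one_sub_finrank_mul_exp_le_measureReal_span_eq_top p
    (StochasticGS.interaction s w hS hW n) (mul_pos hκ hRpos) hκ.le hv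
    (fun x => (StochasticGS.hasSum_norm_inner_interaction_sq s w hS hW n x).summable)
    (fun x => by
      rw [(StochasticGS.hasSum_norm_inner_interaction_sq s w hS hW n x).tsum_eq]
      exact StochasticGS.norm_sq_le_mul_norm_crossOpFin_sq hS hW hgram x)
    P i hi_meas hi_indep hi_law
  have hfail : (n : ℝ) * Real.exp (-(m / (κ * R))) ≤ δ := by
    have hn' : (1 : ℝ) ≤ n := by exact_mod_cast hn
    have hlog : 0 ≤ Real.log (2 * n / δ) := Real.log_nonneg (by rw [le_div_iff₀ hδ0]; linarith)
    have h1 : Real.log (2 * n / δ) ≤ m / (κ * R) := by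
      rw [le_div_iff₀ (mul_pos hκ hRpos)]
      have h2 : 8 / 3 * (κ * R * Real.log (2 * n / δ)) ≤ m := by
        rw [hκdef]
        linarith [hm]
      have h3 : 0 ≤ κ * R * Real.log (2 * n / δ) := by positivity
      linarith
    calc (n : ℝ) * Real.exp (-(m / (κ * R))) ≤ n * Real.exp (-Real.log (2 * n / δ)) := by gcongr
      _ = δ / 2 := by
        rw [Real.exp_neg, Real.exp_log (by positivity)]
        field_simp
      _ ≤ δ := by linarith
  rw [finrank_euclideanSpace_fin] at hspan
  calc 1 - δ ≤ _ := by linarith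
    _ ≤ _ := hspan
    _ ≤ _ := MeasureTheory.measureReal_mono fun ω hω =>
      StochasticGS.existsUnique_isLeastSquaresSol hS hW
        (StochasticGS.isUnit_empGram_of_span_eq_top hS hW hsupp hω) f
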